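/- \textbf{One-bit feedback sum-rate.} Let $N_n,N_f\ge 1$ be integers, $\Omega_p,\Omega_n,\Omega_f>0$, $I>0$, $P_{\mathrm{peak}}>0$, and let $0<a_n<a_f$ with $a_n+a_f=1$. Let $h_p\sim\mathcal{CN}(0,\Omega_p)$, $h_{n,i}\sim\mathcal{CN}(0,\Omega_n)$ $(1\le i\le N_n)$ and $h_{f,j}\sim\mathcal{CN}(0,\Omega_f)$ $(1\le j\le N_f)$ be mutually independent circularly symmetric complex Gaussian channel coefficients, and put $g_p=|h_p|^2$, $g_n=\sum_i|h_{n,i}|^2$, $g_f=\sum_j|h_{f,j}|^2$, $g_{\min}=\min\{g_n,g_f\}$, $\tau=I/P_{\mathrm{peak}}$ and $\Omega=\Omega_n\Omega_f/(\Omega_n+\Omega_f)$. With one-bit feedback the transmit power is $P_t^*=P_{\mathrm{peak}}$ if $g_p\le\tau$ and $P_t^*=0$ otherwise. The average NOMA sum-rate is $$C_{\mathrm{sum}}=\mathbb E\Big[\log_2(1+a_ng_nP_t^*)+\min_{u\in\{n,f\}}\log_2\Big(1+\frac{a_fg_uP_t^*}{a_ng_uP_t^*+1}\Big)\Big].$$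 Then the random variable in this expectation is integrable, so is the one in the following expectation, $$C_{\mathrm{sum}}=\mathbb E\big[\log_2(1+a_nP_t^*g_n)+\log_2(1+P_t^*g_{\min})-\log_2(1+a_nP_t^*g_{\min})\big],$$ and, writing $$\mathcal G_N(z)=G^{3,1}_{2,3}\left(z\,\middle|\,\begin{matrix}-N,\ 1-N\\ 0,\ -N,\ -N\end{matrix}\right)$$ for Meijer's $G$-function with these parameters, i.e. $$\mathcal G_N(z)=\frac1{2\pi i}\int_{\sigma-i\infty}^{\sigma+i\infty}\frac{\Gamma(-s)\,\Gamma(-N-s)^2\,\Gamma(1+N+s)}{\Gamma(1-N-s)}\,z^s\,ds,\qquad -N-1<\sigma<-N,$$ one has $$\begin{aligned}C_{\mathrm{sum}}=\frac{1-e^{-\tau/\Omega_p}}{\ln 2}\Bigg[&\frac{1}{\Gamma(N_n)\,\Omega_n^{N_n}(a_nP_{\mathrm{peak}})^{N_n}}\,\mathcal G_{N_n}\!\Big(\frac1{\Omega_na_nP_{\mathrm{peak}}}\Big)\\ &+\frac1{\Gamma(N_n)\,\Omega_n^{N_n}}\sum_{k=0}^{N_f-1}\frac1{k!\,\Omega_f^k\,P_{\mathrm{peak}}^{N_n+k}}\Big\{\mathcal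 G_{N_n+k}\!\Big(\frac1{\Omega P_{\mathrm{peak}}}\Big)-\frac1{a_n^{N_n+k}}\,\mathcal G_{N_n+k}\!\Big(\frac1{\Omega a_nP_{\mathrm{peak}}}\Big)\Big\}\\ &+\frac1{\Gamma(N_f)\,\Omega_f^{N_f}}\sum_{l=0}^{N_n-1}\frac1{l!\,\Omega_n^l\,P_{\mathrm{peak}}^{N_f+l}}\Big\{\mathcal G_{N_f+l}\!\Big(\frac1{\Omega P_{\mathrm{peak}}}\Big)-\frac1{a_n^{N_f+l}}\,\mathcal G_{N_f+l}\!\Big(\frac1{\Omega a_nP_{\mathrm{peak}}}\Big)\Big\}\Bigg].\end{aligned}$$ -/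

import Mathlib

open MeasureTheory ProbabilityTheory

noncomputable section

namespace NOMA

/-! ## Meijer's G-function -/

/-- The Mellin-Barnes integrand of `G^{m,n}_{p,q}(z | a ; b)` at the point `s`:
`∏_{j ≤ m} Γ(b_j - s) ∏_{j ≤ n} Γ(1 - a_j + s) z ^ s` divided by
`∏_{m < j ≤ q} Γ(1 - b_j + s) ∏_{n < j ≤ p} Γ(a_j - s)` (indices shifted to start at `0`). -/
def meijerIntegrand (m n : ℕ) {p q : ℕ} (a : Fin p → ℂ) (b : Fin q → ℂ) (z s : ℂ) : ℂ :=
  (∏ j : Fin q, if (j : ℕ) < m then Complex.Gamma (b j - s)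
      else (Complex.Gamma (1 - b j + s))⁻¹) *
  (∏ j : Fin p, if (j : ℕ) < n then Complex.Gamma (1 - a j + s)
      else (Complex.Gamma (a j - s))⁻¹) * z ^ s

/-- The vertical line `Re s = σ` separates the two families of poles: those of
`Γ(1 - a_j + s)`, `j ≤ n`, at `a_j - 1 - ℓ`, lie strictly to its left and those of
`Γ(b_j - s)`, `j ≤ m`, at `b_j + ℓ`, lie strictly to its right (`ℓ = 0, 1, 2, …`). -/
def MeijerSeparates (m n : ℕ) {p q : ℕ} (a : Fin p → ℂ) (b : Fin q → ℂ) (σ : ℝ) : Prop :=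
  (∀ j : Fin p, (j : ℕ) < n → (a j).re - 1 < σ) ∧
  (∀ j : Fin q, (j : ℕ) < m → σ < (b j).re)

open Classical in
/-- Meijer's function `G^{m,n}_{p,q}(z | a ; b) = (1 / 2πi) ∫_L integrand(s) ds`, where `L` is a
vertical line `s = σ + i t` (so `ds = i dt`), traversed upwards, which separates the two families
of poles. Where the integral converges absolutely for all separating lines (in particular for
`|arg z| < (m + n - (p + q) / 2) π`), its value does not depend on the line, by Cauchy's theorem.
Parameters for which only an indented line separates the poles are not covered (value `0`). -/
def meijerG (m n : ℕ) {p q : ℕ} (a : Fin p → ℂ) (b : Fin q → ℂ) (z : ℂ) : ℂ :=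
  if h : ∃ σ : ℝ, MeijerSeparates m n a b σ then
    (1 / (2 * (Real.pi : ℂ))) *
      ∫ t : ℝ, meijerIntegrand m n a b z ((h.choose : ℂ) + (t : ℂ) * Complex.I)
  else 0

/-- The function `G^{3,1}_{2,3}(z | -N, 1 - N ; 0, -N, -N)`, at a real argument `z`. -/
def gTerm (N : ℕ) (z : ℝ) : ℂ :=
  meijerG 3 1 ![-(N : ℂ), 1 - (N : ℂ)] ![0, -(N : ℂ), -(N : ℂ)] (z : ℂ)

/-- In `gTerm` the separating vertical lines are exactly those with `-N - 1 < σ < -N`. -/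
theorem meijerSeparates_gTerm_iff (N : ℕ) (σ : ℝ) :
    MeijerSeparates 3 1 ![-(N : ℂ), 1 - (N : ℂ)] ![0, -(N : ℂ), -(N : ℂ)] σ ↔
      -(N : ℝ) - 1 < σ ∧ σ < -(N : ℝ) := by
  have h0 : (0 : ℝ) ≤ N := Nat.cast_nonneg N
  simp only [MeijerSeparates, Fin.forall_fin_succ, Fin.forall_fin_zero]
  simp
  intro _ h
  linarith

/-! ## The channel -/

/-- The circularly symmetric complex normal law `CN(0, v)`: real and imaginary part are independent
real Gaussians with mean `0` and variance `v / 2`. -/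
def complexNormal (v : ℝ) : Measure ℂ :=
  ((gaussianReal 0 (v / 2).toNNReal).prod (gaussianReal 0 (v / 2).toNNReal)).map
    Complex.measurableEquivRealProd.symm

/-- Channel gain `hᴴ h = ∑ i, |h i| ^ 2` after maximal-ratio combining over the receive antennas. -/
def mrcGain {N : ℕ} (h : Fin N → ℂ) : ℝ := ∑ i, ‖h i‖ ^ 2

/-- Transmit power under one-bit feedback: `Ppeak` if `gp ≤ τ = I / Ppeak`, silence otherwise. -/
def oneBitPower (I Ppeak gp : ℝ) : ℝ := if gp ≤ I / Ppeak then Ppeak else 0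

/-- SINR for decoding the far user's symbol at a receiver with channel gain `g`, when the transmit
power is `P`. -/
def sinrFar (an af P g : ℝ) : ℝ := af * g * P / (an * g * P + 1)

/-- SNR for decoding the near user's symbol at the near user, after interference cancellation. -/
def snrNear (an P g : ℝ) : ℝ := an * g * P

/-- Instantaneous NOMA sum-rate: rate `log₂ (1 + SNR)` of the near user, plus rate of the far user,
whose symbol has to be decoded at both receivers. -/
def sumRate (an af P gn gf : ℝ) : ℝ :=
  Real.logb 2 (1 + snrNear an P gn) +
    min (Real.logb 2 (1 + sinrFar an af P gn)) (Real.logb 2 (1 + sinrFar an af P gf))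

/-- Instantaneous NOMA sum-rate with one-bit feedback, as a function of the channel coefficients. -/
def oneBitSumRate (an af I Ppeak : ℝ) {Nn Nf : ℕ} (hp : ℂ) (hn : Fin Nn → ℂ) (hf : Fin Nf → ℂ) :
    ℝ :=
  sumRate an af (oneBitPower I Ppeak (‖hp‖ ^ 2)) (mrcGain hn) (mrcGain hf)

/-- The same rate in the form
`log₂ (1 + an P gn) + log₂ (1 + P gmin) - log₂ (1 + an P gmin)`, with `gmin = min gn gf`. -/
def oneBitSumRateMin (an I Ppeak : ℝ) {Nn Nf : ℕ} (hp : ℂ) (hn : Fin Nn → ℂ)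
    (hf : Fin Nf → ℂ) : ℝ :=
  let P := oneBitPower I Ppeak (‖hp‖ ^ 2)
  let gmin := min (mrcGain hn) (mrcGain hf)
  Real.logb 2 (1 + an * P * mrcGain hn) + Real.logb 2 (1 + P * gmin)
    - Real.logb 2 (1 + an * P * gmin)

end NOMA

end

/-!
The Laplace integral `∫_0^∞ log (1 + y) y ^ (a - 1) e ^ (-z y) dy` has a Mellin transform which is
a product of Gamma functions; the decay of `Γ` along vertical lines allows inversion, and for
`a = N` the inversion formula is the Mellin-Barnes integral defining `gTerm N z`. Hence the average
of `log (1 + c g)` over a gamma-distributed gain `g` of integer shape is an explicit multiple of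
a value of `gTerm`.

The combined gains are gamma distributed, as their moment generating functions show. An average of
a function of the smaller of the two gains splits according to which one is smaller, and this
weights the density of one gain with the upper tail of the other. For integer shapes that tail is
an exponential times a polynomial, so the weighted density is a combination of gamma densities
whose rate is the sum `1/Ωn + 1/Ωf = 1/Ω` and whose shapes are `Nn + k` or `Nf + l`.

With one-bit feedback the power only switches the rate on or off, independently of the two gains,
which contributes the factor `1 - e ^ (-τ / Ωp)`, the probability of sending.
-/

noncomputable section

namespace NOMA

open Set Filter Topology

section LaplaceMellin

variable {g : ℝ → ℂ} {w : ℂ}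

theorem aestronglyMeasurable_ofReal_cpow (w : ℂ) :
    AEStronglyMeasurable (fun x : ℝ => (x : ℂ) ^ w) (volume.restrict (Ioi 0)) :=
  ContinuousOn.aestronglyMeasurable (fun x (hx : 0 < x) =>
    (Complex.continuousAt_ofReal_cpow_const x w (Or.inr hx.ne')).continuousWithinAt)
    measurableSet_Ioi

theorem aestronglyMeasurable_of_mellinConvergent (hg : MellinConvergent g w) :
    AEStronglyMeasurable g (volume.restrict (Ioi 0)) := by
  refine ((aestronglyMeasurable_ofReal_cpow (1 - w)).mul hg.aestronglyMeasurable).congr ?_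
  filter_upwards [ae_restrict_mem measurableSet_Ioi] with x (hx : 0 < x)
  rw [Pi.mul_apply, smul_eq_mul, ← mul_assoc,
    ← Complex.cpow_add _ _ (Complex.ofReal_ne_zero.mpr hx.ne'), sub_add_sub_cancel, sub_self,
    Complex.cpow_zero, one_mul]

theorem hasMellin_congr {f : ℝ → ℂ} {m : ℂ} (hfg : EqOn f g (Ioi 0)) (hf : HasMellin f w m) :
    HasMellin g w m := by
  have h : EqOn (fun x : ℝ => (x : ℂ) ^ (w - 1) • f x) (fun x => (x : ℂ) ^ (w - 1) • g x)
      (Ioi 0) := fun x hx => congrArg (_ • ·) (hfg hx)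
  exact ⟨(integrableOn_congr_fun h measurableSet_Ioi).mp hf.1,
    (setIntegral_congr_fun measurableSet_Ioi h).symm.trans hf.2⟩

/-- The Laplace transform of `g` at real arguments. -/
def laplaceIntegral (g : ℝ → ℂ) (z : ℝ) : ℂ :=
  ∫ y in Ioi (0 : ℝ), g y * (Real.exp (-(z * y)) : ℂ)

/-- The integrand of the double integral which is the Mellin transform at `w` of the Laplace
transform of `g`. -/
def mellinLaplaceKernel (g : ℝ → ℂ) (w : ℂ) (p : ℝ × ℝ) : ℂ :=
  (p.1 : ℂ) ^ (w - 1) * (g p.2 * (Real.exp (-(p.1 * p.2)) : ℂ))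

theorem aestronglyMeasurable_mellinLaplaceKernel
    (hg : AEStronglyMeasurable g (volume.restrict (Ioi 0))) :
    AEStronglyMeasurable (mellinLaplaceKernel g w)
      ((volume.restrict (Ioi 0)).prod (volume.restrict (Ioi 0))) :=
  (aestronglyMeasurable_ofReal_cpow (w - 1)).comp_fst.mul
    (hg.comp_snd.mul (Continuous.aestronglyMeasurable (by fun_prop)))

theorem norm_mellinLaplaceKernel {x : ℝ} (hx : 0 < x) (y : ℝ) :
    ‖mellinLaplaceKernel g w (x, y)‖ = ‖g y‖ * (x ^ (w.re - 1) * Real.exp (-(y * x))) := by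
  rw [mellinLaplaceKernel, norm_mul, norm_mul, Complex.norm_cpow_eq_rpow_re_of_pos hx,
    Complex.norm_of_nonneg (Real.exp_pos _).le, Complex.sub_re, Complex.one_re, mul_comm x y]
  ring

theorem integrableOn_rpow_mul_exp_neg_mul {s z : ℝ} (hs : -1 < s) (hz : 0 < z) :
    IntegrableOn (fun x : ℝ => x ^ s * Real.exp (-(z * x))) (Ioi 0) := by
  simpa using integrableOn_rpow_mul_exp_neg_mul_rpow (p := 1) hs one_pos hz

theorem integrable_mellinLaplaceKernel (hw : 0 < w.re) (hg : MellinConvergent g (1 - w)) :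
    Integrable (mellinLaplaceKernel g w)
      ((volume.restrict (Ioi 0)).prod (volume.restrict (Ioi 0))) := by
  have hmeas := aestronglyMeasurable_mellinLaplaceKernel (w := w)
    (aestronglyMeasurable_of_mellinConvergent hg)
  rw [integrable_prod_iff' hmeas]
  constructor
  · filter_upwards [ae_restrict_mem measurableSet_Ioi, hmeas.prodMk_right]
      with y (hy : 0 < y) hmeas_y
    have hnorm : IntegrableOn (fun x => ‖mellinLaplaceKernel g w (x, y)‖) (Ioi 0) :=
      (integrableOn_congr_fun (fun x hx => norm_mellinLaplaceKernel hx y) measurableSet_Ioi).mpr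
        ((integrableOn_rpow_mul_exp_neg_mul (by linarith) hy).const_mul _)
    exact (integrable_norm_iff hmeas_y).mp hnorm
  · refine (hg.norm.mul_const (Real.Gamma w.re)).congr ?_
    filter_upwards [ae_restrict_mem measurableSet_Ioi] with y (hy : 0 < y)
    rw [setIntegral_congr_fun measurableSet_Ioi (fun x hx => norm_mellinLaplaceKernel hx y),
      integral_const_mul, Real.integral_rpow_mul_exp_neg_mul_Ioi hw hy, norm_smul,
      Complex.norm_cpow_eq_rpow_re_of_pos hy, one_div, Real.inv_rpow hy.le,
      ← Real.rpow_neg hy.le, sub_sub_cancel_left, Complex.neg_re]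
    ring

theorem integral_mellinLaplaceKernel_left (hw : 0 < w.re) {y : ℝ} (hy : 0 < y) :
    ∫ x in Ioi (0 : ℝ), mellinLaplaceKernel g w (x, y) =
      Complex.Gamma w * ((y : ℂ) ^ (1 - w - 1) • g y) := by
  have hkernel : ∀ x : ℝ, mellinLaplaceKernel g w (x, y) =
      g y * ((x : ℂ) ^ (w - 1) * Complex.exp (-(y * x))) := fun x => by
    simp only [mellinLaplaceKernel, Complex.ofReal_exp, Complex.ofReal_neg, Complex.ofReal_mul,
      mul_comm (x : ℂ) y]
    ring
  have harg : (y : ℂ).arg ≠ Real.pi := by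
    rw [Complex.arg_ofReal_of_nonneg hy.le]; exact Real.pi_pos.ne
  simp only [hkernel]
  rw [integral_const_mul, Complex.integral_cpow_mul_exp_neg_mul_Ioi hw hy, one_div,
    Complex.inv_cpow _ _ harg, ← Complex.cpow_neg, smul_eq_mul, sub_sub_cancel_left]
  ring

theorem hasMellin_laplaceIntegral (hw : 0 < w.re) (hg : MellinConvergent g (1 - w)) :
    HasMellin (laplaceIntegral g) w (Complex.Gamma w * mellin g (1 - w)) := by
  have hint := integrable_mellinLaplaceKernel hw hg
  have hright : ∀ x : ℝ, ∫ y in Ioi (0 : ℝ), mellinLaplaceKernel g w (x, y) =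
      (x : ℂ) ^ (w - 1) • laplaceIntegral g x := fun x => by
    simp only [mellinLaplaceKernel, laplaceIntegral, integral_const_mul, smul_eq_mul]
  refine ⟨by
    simpa only [MellinConvergent, IntegrableOn, hright] using hint.integral_prod_left, ?_⟩
  calc mellin (laplaceIntegral g) w
      = ∫ x in Ioi (0 : ℝ), ∫ y in Ioi (0 : ℝ), mellinLaplaceKernel g w (x, y) := by
        simp only [hright, mellin]
    _ = ∫ y in Ioi (0 : ℝ), ∫ x in Ioi (0 : ℝ), mellinLaplaceKernel g w (x, y) :=
        integral_integral_swap (f := fun x y => mellinLaplaceKernel g w (x, y)) hint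
    _ = Complex.Gamma w * mellin g (1 - w) := by
        rw [mellin, ← integral_const_mul]
        exact setIntegral_congr_fun measurableSet_Ioi fun y hy =>
          integral_mellinLaplaceKernel_left hw hy

theorem hasMellin_of_hasDerivAt {u u' : ℝ → ℂ} {m : ℂ} (hw : w ≠ 0)
    (hderiv : ∀ y ∈ Ioi (0 : ℝ), HasDerivAt u (u' y) y) (hu : MellinConvergent u w)
    (hu' : HasMellin u' (w + 1) m)
    (hzero : Tendsto (fun y : ℝ => u y * (y : ℂ) ^ w) (𝓝[>] 0) (𝓝 0))
    (htop : Tendsto (fun y : ℝ => u y * (y : ℂ) ^ w) atTop (𝓝 0)) :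
    HasMellin u w (m / -w) := by
  refine ⟨hu, ?_⟩
  have hpow : ∀ y ∈ Ioi (0 : ℝ),
      HasDerivAt (fun y : ℝ => (y : ℂ) ^ w / w) ((y : ℂ) ^ (w - 1)) y := fun y (hy : 0 < y) => by
    simpa using hasDerivAt_ofReal_cpow_const' (r := w - 1) hy.ne'
      fun h => hw (by linear_combination h)
  have hparts := integral_Ioi_mul_deriv_eq_deriv_mul (a' := 0) (b' := 0) hderiv hpow
    (hu.congr (ae_of_all _ fun y => mul_comm _ _))
    ((hu'.1.const_mul w⁻¹).congr (ae_of_all _ fun y => by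
      simp only [Pi.mul_apply, smul_eq_mul, add_sub_cancel_right]; ring))
    (by simpa [Pi.mul_def, mul_div_assoc] using hzero.div_const w)
    (by simpa [Pi.mul_def, mul_div_assoc] using htop.div_const w)
  have hderivTerm : ∫ y in Ioi (0 : ℝ), u' y * ((y : ℂ) ^ w / w) = w⁻¹ * m := by
    rw [← hu'.2, mellin, ← integral_const_mul]
    congr 1 with y
    rw [smul_eq_mul, add_sub_cancel_right]
    ring
  calc mellin u w = ∫ y in Ioi (0 : ℝ), u y * (y : ℂ) ^ (w - 1) := by
        simp only [mellin, smul_eq_mul, mul_comm]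
    _ = m / -w := by rw [hparts, hderivTerm, sub_self, zero_sub]; ring

end LaplaceMellin

section LogOneAdd

theorem laplaceIntegral_exp_neg {z : ℝ} (hz : -1 < z) :
    laplaceIntegral (fun t : ℝ => (Real.exp (-t) : ℂ)) z = ((1 + z : ℝ) : ℂ)⁻¹ := by
  have hexp : ∀ y : ℝ, (Real.exp (-y) : ℂ) * (Real.exp (-(z * y)) : ℂ) =
      ((Real.exp (-(1 + z) * y) : ℝ) : ℂ) := fun y => by
    rw [← Complex.ofReal_mul, ← Real.exp_add]; congr 2; ring
  simp only [laplaceIntegral, hexp]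
  rw [integral_complex_ofReal, integral_exp_mul_Ioi (by linarith), mul_zero, Real.exp_zero,
    neg_div_neg_eq, one_div, Complex.ofReal_inv]

theorem hasMellin_exp_neg {s : ℂ} (hs : 0 < s.re) :
    HasMellin (fun t : ℝ => (Real.exp (-t) : ℂ)) s (Complex.Gamma s) :=
  ⟨(Complex.GammaIntegral_convergent hs).congr (ae_of_all _ fun _ => mul_comm _ _), by
    rw [Complex.Gamma_eq_integral hs, Complex.GammaIntegral_eq_mellin]⟩

theorem hasMellin_inv_one_add {s : ℂ} (h0 : 0 < s.re) (h1 : s.re < 1) :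
    HasMellin (fun y : ℝ => ((1 + y : ℝ) : ℂ)⁻¹) s (Complex.Gamma s * Complex.Gamma (1 - s)) := by
  have hexp := hasMellin_exp_neg (s := 1 - s) (by simpa using h1)
  have hlaplace := hasMellin_laplaceIntegral h0 hexp.1
  rw [hexp.2] at hlaplace
  exact hasMellin_congr (fun z (hz : 0 < z) => laplaceIntegral_exp_neg (by linarith)) hlaplace

theorem log_one_add_le_rpow_div {y ε : ℝ} (hy : 0 ≤ y) (h0 : 0 < ε) (h1 : ε ≤ 1) :
    Real.log (1 + y) ≤ y ^ ε / ε := by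
  rw [le_div_iff₀ h0, mul_comm, ← Real.log_rpow (by linarith)]
  calc Real.log ((1 + y) ^ ε) ≤ (1 + y) ^ ε - 1 :=
        Real.log_le_sub_one_of_pos (Real.rpow_pos_of_pos (by linarith) _)
    _ ≤ y ^ ε := by
        simpa [add_comm] using Real.rpow_add_le_add_rpow zero_le_one hy h0.le h1

theorem norm_log_one_add_le {y ε : ℝ} (hy : 0 ≤ y) (h0 : 0 < ε) (h1 : ε ≤ 1) :
    ‖(Real.log (1 + y) : ℂ)‖ ≤ y ^ ε / ε := by
  rw [Complex.norm_of_nonneg (Real.log_nonneg (by linarith))]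
  exact log_one_add_le_rpow_div hy h0 h1

theorem hasDerivAt_ofReal_log_one_add {y : ℝ} (hy : 1 + y ≠ 0) :
    HasDerivAt (fun y : ℝ => (Real.log (1 + y) : ℂ)) ((1 + y : ℝ) : ℂ)⁻¹ y := by
  simpa using (((hasDerivAt_id y).const_add 1).log hy).ofReal_comp

theorem mellinConvergent_log_one_add {s : ℂ} (h0 : -1 < s.re) (h1 : s.re < 0) :
    MellinConvergent (fun y : ℝ => (Real.log (1 + y) : ℂ)) s := by
  have hcont : ContinuousOn (fun y : ℝ => (Real.log (1 + y) : ℂ)) (Ioi 0) :=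
    fun y (hy : 0 < y) => (hasDerivAt_ofReal_log_one_add
      (by linarith)).continuousAt.continuousWithinAt
  refine mellinConvergent_of_isBigO_rpow (a := s.re / 2) (b := -1)
    (hcont.locallyIntegrableOn measurableSet_Ioi) ?_ (by linarith) ?_ h0
  · refine Asymptotics.IsBigO.of_bound (-(s.re / 2))⁻¹ ?_
    filter_upwards [eventually_gt_atTop 0] with y hy
    rw [Real.norm_of_nonneg (Real.rpow_nonneg hy.le _), inv_mul_eq_div]
    exact norm_log_one_add_le hy.le (by linarith) (by linarith)
  · refine Asymptotics.IsBigO.of_bound 1 ?_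
    filter_upwards [self_mem_nhdsWithin] with y (hy : 0 < y)
    simpa [Real.norm_of_nonneg hy.le] using norm_log_one_add_le hy.le one_pos le_rfl

theorem norm_log_one_add_mul_cpow_le {s : ℂ} {y ε : ℝ} (hy : 0 < y) (h0 : 0 < ε) (h1 : ε ≤ 1) :
    ‖(Real.log (1 + y) : ℂ) * (y : ℂ) ^ s‖ ≤ y ^ (ε + s.re) / ε := by
  rw [norm_mul, Complex.norm_cpow_eq_rpow_re_of_pos hy, Real.rpow_add hy, mul_div_right_comm]
  gcongr
  exact norm_log_one_add_le hy.le h0 h1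

theorem tendsto_log_one_add_mul_cpow_nhdsGT_zero {s : ℂ} (hs : -1 < s.re) :
    Tendsto (fun y : ℝ => (Real.log (1 + y) : ℂ) * (y : ℂ) ^ s) (𝓝[>] 0) (𝓝 0) := by
  have hpow : Tendsto (fun y : ℝ => y ^ (1 + s.re) / 1) (𝓝[>] 0) (𝓝 0) := by
    have h := (Real.continuousAt_rpow_const 0 (1 + s.re) (Or.inr (by linarith))).tendsto
    rw [Real.zero_rpow (by linarith)] at h
    simpa only [div_one] using h.mono_left nhdsWithin_le_nhds
  refine squeeze_zero_norm' ?_ hpow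
  filter_upwards [self_mem_nhdsWithin] with y (hy : 0 < y)
  exact norm_log_one_add_mul_cpow_le hy one_pos le_rfl

theorem tendsto_log_one_add_mul_cpow_atTop {s : ℂ} (h0 : -1 < s.re) (h1 : s.re < 0) :
    Tendsto (fun y : ℝ => (Real.log (1 + y) : ℂ) * (y : ℂ) ^ s) atTop (𝓝 0) := by
  have hε : 0 < -(s.re / 2) := by linarith
  have hpow : Tendsto (fun y : ℝ => y ^ (-(s.re / 2) + s.re) / -(s.re / 2)) atTop (𝓝 0) := by
    have h := (tendsto_rpow_neg_atTop hε).div_const (-(s.re / 2))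
    rwa [zero_div, show - -(s.re / 2) = -(s.re / 2) + s.re by ring] at h
  refine squeeze_zero_norm' ?_ hpow
  filter_upwards [eventually_gt_atTop 0] with y hy
  exact norm_log_one_add_mul_cpow_le hy hε (by linarith)

theorem hasMellin_log_one_add {s : ℂ} (h0 : -1 < s.re) (h1 : s.re < 0) :
    HasMellin (fun y : ℝ => (Real.log (1 + y) : ℂ)) s
      (Complex.Gamma (s + 1) * Complex.Gamma (-s) / -s) := by
  have hinv := hasMellin_inv_one_add (s := s + 1) (by simp; linarith) (by simp; linarith)
  rw [show 1 - (s + 1) = -s by ring] at hinv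
  exact hasMellin_of_hasDerivAt (fun h => by simp [h] at h1)
    (fun y (hy : 0 < y) => hasDerivAt_ofReal_log_one_add (by linarith))
    (mellinConvergent_log_one_add h0 h1) hinv (tendsto_log_one_add_mul_cpow_nhdsGT_zero h0)
    (tendsto_log_one_add_mul_cpow_atTop h0 h1)

end LogOneAdd

section GammaDecay

theorem norm_Gamma_le_Gamma_re {s : ℂ} (hs : 0 < s.re) : ‖Complex.Gamma s‖ ≤ Real.Gamma s.re := by
  rw [Complex.Gamma_eq_integral hs, Complex.GammaIntegral, Real.Gamma_eq_integral hs]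
  refine (norm_integral_le_integral_norm _).trans_eq ?_
  refine setIntegral_congr_fun measurableSet_Ioi fun x (hx : 0 < x) => ?_
  rw [norm_mul, Complex.norm_of_nonneg (Real.exp_pos _).le,
    Complex.norm_cpow_eq_rpow_re_of_pos hx, Complex.sub_re, Complex.one_re]

theorem continuousAt_Gamma_of_re_pos {s : ℂ} (hs : 0 < s.re) : ContinuousAt Complex.Gamma s :=
  Complex.continuousAt_Gamma s fun m h => by
    have hm : s.re = -m := by simp [h]
    linarith [(Nat.cast_nonneg m : (0 : ℝ) ≤ m)]

/-- Two steps of the functional equation give quadratic decay, enough for integrability on vertical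
lines without Stirling's formula. -/
theorem norm_Gamma_le_div_normSq {s : ℂ} (hs : 0 < s.re) :
    ‖Complex.Gamma s‖ ≤ Real.Gamma (s.re + 1 + 1) / Complex.normSq s := by
  have hs0 : s ≠ 0 := fun h => by simp [h] at hs
  have hre : 0 < (s + 1).re := by simp; linarith
  have hs1 : s + 1 ≠ 0 := fun h => by simp [h] at hre
  have hnorm : ‖s‖ ≤ ‖s + 1‖ := by
    rw [← sq_le_sq₀ (norm_nonneg _) (norm_nonneg _), ← Complex.normSq_eq_norm_sq,
      ← Complex.normSq_eq_norm_sq, Complex.normSq_apply, Complex.normSq_apply, Complex.add_re,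
      Complex.add_im, Complex.one_re, Complex.one_im]
    nlinarith
  rw [le_div_iff₀ (Complex.normSq_pos.mpr hs0), Complex.normSq_eq_norm_sq, sq]
  calc ‖Complex.Gamma s‖ * (‖s‖ * ‖s‖) ≤ ‖Complex.Gamma s‖ * (‖s + 1‖ * ‖s‖) := by gcongr
    _ = ‖Complex.Gamma (s + 1 + 1)‖ := by
        rw [Complex.Gamma_add_one _ hs1, Complex.Gamma_add_one _ hs0, norm_mul, norm_mul]; ring
    _ ≤ Real.Gamma (s.re + 1 + 1) := by
        simpa using norm_Gamma_le_Gamma_re (s := s + 1 + 1) (by simp; linarith)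

theorem continuous_Gamma_vertical {c : ℝ} (hc : 0 < c) :
    Continuous fun t : ℝ => Complex.Gamma (c + t * Complex.I) :=
  continuous_iff_continuousAt.mpr fun t =>
    (continuousAt_Gamma_of_re_pos (s := c + t * Complex.I) (by simpa)).comp
      (f := fun t : ℝ => (c + t * Complex.I : ℂ)) (by fun_prop)

theorem verticalIntegrable_Gamma {c : ℝ} (hc : 0 < c) :
    Complex.VerticalIntegrable Complex.Gamma c := by
  have hbound : Integrable fun t : ℝ => Real.Gamma (c + 1 + 1) / c ^ 2 * (1 + (t / c) ^ 2)⁻¹ :=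
    (integrable_inv_one_add_sq.comp_div hc.ne').const_mul _
  refine hbound.mono' (continuous_Gamma_vertical hc).aestronglyMeasurable
    (ae_of_all _ fun t => ?_)
  have hdecay := norm_Gamma_le_div_normSq (s := c + t * Complex.I) (by simpa)
  have hre : (c + t * Complex.I : ℂ).re = c := by simp
  rw [hre, Complex.normSq_add_mul_I] at hdecay
  calc ‖Complex.Gamma (c + t * Complex.I)‖ ≤ Real.Gamma (c + 1 + 1) / (c ^ 2 + t ^ 2) := hdecay
    _ = Real.Gamma (c + 1 + 1) / c ^ 2 * (1 + (t / c) ^ 2)⁻¹ := by field_simp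

end GammaDecay

section MeijerLaplace

/-- The integral `∫_0^∞ log (1 + y) y ^ (a - 1) e ^ (-z y) dy`, the common closed form of the
averages of logarithmic rates over Gamma-distributed channel gains and of the values of `gTerm`. -/
def logLaplace (a z : ℝ) : ℝ :=
  ∫ y in Ioi (0 : ℝ), Real.log (1 + y) * y ^ (a - 1) * Real.exp (-(z * y))

/-- The Mellin transform of `logLaplace a` at `w`. For `a = N` it is, up to the factor `z ^ (-w)`,
the Mellin-Barnes integrand of `gTerm N z` at `s = -w`, in which one factor `Γ(w - a)` has been
cancelled by means of `Γ(w - a + 1) = (w - a) Γ(w - a)`. -/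
def barnesKernel (a : ℝ) (w : ℂ) : ℂ :=
  Complex.Gamma w * (Complex.Gamma (a - w + 1) * Complex.Gamma (w - a) / (w - a))

variable {a z : ℝ}

theorem log_one_add_mul_rpow_mul_exp_le {y : ℝ} (hy : 0 < y) :
    ‖Real.log (1 + y) * y ^ (a - 1) * Real.exp (-(z * y))‖ ≤ y ^ a * Real.exp (-(z * y)) := by
  have hlog : Real.log (1 + y) ≤ y := by
    simpa using log_one_add_le_rpow_div hy.le one_pos le_rfl
  rw [Real.norm_of_nonneg (by have := Real.log_nonneg (show 1 ≤ 1 + y by linarith); positivity)]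
  gcongr
  calc Real.log (1 + y) * y ^ (a - 1) ≤ y * y ^ (a - 1) := by gcongr
    _ = y ^ a := by rw [mul_comm, ← Real.rpow_add_one hy.ne', sub_add_cancel]

theorem integrableOn_log_one_add_mul_rpow_mul_exp (ha : -1 < a) (hz : 0 < z) :
    IntegrableOn (fun y : ℝ => Real.log (1 + y) * y ^ (a - 1) * Real.exp (-(z * y))) (Ioi 0) :=
  (integrableOn_rpow_mul_exp_neg_mul ha hz).mono' (by fun_prop)
    ((ae_restrict_mem measurableSet_Ioi).mono fun _ hy => log_one_add_mul_rpow_mul_exp_le hy)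

theorem continuousAt_logLaplace (ha : -1 < a) (hz : 0 < z) : ContinuousAt (logLaplace a) z := by
  refine continuousAt_of_dominated (bound := fun y => y ^ a * Real.exp (-(z / 2 * y)))
    (Eventually.of_forall fun x => by fun_prop) ?_
    (integrableOn_rpow_mul_exp_neg_mul ha (half_pos hz)) (ae_of_all _ fun y => by fun_prop)
  filter_upwards [eventually_gt_nhds (half_lt_self hz)] with x hx
  filter_upwards [ae_restrict_mem measurableSet_Ioi] with y (hy : 0 < y)
  refine (log_one_add_mul_rpow_mul_exp_le hy).trans ?_
  gcongr

theorem laplaceIntegral_cpow_smul_log_one_add (a z : ℝ) :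
    laplaceIntegral (fun y => (y : ℂ) ^ ((a : ℂ) - 1) • (Real.log (1 + y) : ℂ)) z =
      (logLaplace a z : ℂ) := by
  rw [laplaceIntegral, logLaplace, ← integral_complex_ofReal]
  refine setIntegral_congr_fun measurableSet_Ioi fun y (hy : 0 < y) => ?_
  simp only [smul_eq_mul, Complex.ofReal_mul, Complex.ofReal_cpow hy.le, Complex.ofReal_sub,
    Complex.ofReal_one]
  ring

theorem hasMellin_logLaplace {w : ℂ} (hw : 0 < w.re) (h0 : a < w.re) (h1 : w.re < a + 1) :
    HasMellin (fun z => (logLaplace a z : ℂ)) w (barnesKernel a w) := by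
  have hlog := hasMellin_log_one_add (s := a - w) (by simp; linarith) (by simp; linarith)
  have hshift : 1 - w + ((a : ℂ) - 1) = a - w := by ring
  have hconv : MellinConvergent
      (fun y : ℝ => (y : ℂ) ^ ((a : ℂ) - 1) • (Real.log (1 + y) : ℂ)) (1 - w) := by
    rw [MellinConvergent.cpow_smul, hshift]; exact hlog.1
  have hlaplace := hasMellin_laplaceIntegral hw hconv
  rw [mellin_cpow_smul, hshift, hlog.2, neg_sub] at hlaplace
  exact hasMellin_congr (fun z _ => laplaceIntegral_cpow_smul_log_one_add a z) hlaplace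

theorem verticalIntegrable_barnesKernel {ρ : ℝ} (hρ : 0 < ρ) (h0 : a < ρ) (h1 : ρ < a + 1) :
    Complex.VerticalIntegrable (barnesKernel a) ρ := by
  have hleft : 0 < a - ρ + 1 := by linarith
  have hright : 0 < ρ - a := by linarith
  have hline_left (t : ℝ) : (a - (ρ + t * Complex.I) + 1 : ℂ) =
      (a - ρ + 1 : ℝ) + (-t : ℝ) * Complex.I := by push_cast; ring
  have hline_right (t : ℝ) : (ρ + t * Complex.I - a : ℂ) = (ρ - a : ℝ) + t * Complex.I := by
    push_cast; ring
  have hre (c t : ℝ) : (c + t * Complex.I : ℂ).re = c := by simp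
  refine (verticalIntegrable_Gamma hρ).mul_bdd
    (c := Real.Gamma (a - ρ + 1) * Real.Gamma (ρ - a) / (ρ - a)) ?_ (ae_of_all _ fun t => ?_)
  · simp only [hline_left, hline_right]
    refine (((continuous_Gamma_vertical hleft).comp continuous_neg).mul
      (continuous_Gamma_vertical hright)).div (by fun_prop) (fun t h => ?_) |>.aestronglyMeasurable
    have := congrArg Complex.re h
    rw [hre, Complex.zero_re] at this
    linarith
  · simp only [hline_left, hline_right, norm_div, norm_mul]
    have hΓleft := norm_Gamma_le_Gamma_re (s := (a - ρ + 1 : ℝ) + (-t : ℝ) * Complex.I)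
      (by rwa [hre])
    have hΓright := norm_Gamma_le_Gamma_re (s := (ρ - a : ℝ) + t * Complex.I) (by rwa [hre])
    have hden := Complex.re_le_norm ((ρ - a : ℝ) + t * Complex.I)
    rw [hre] at hΓleft hΓright hden
    gcongr

theorem logLaplace_eq_integral_barnesKernel {ρ : ℝ} (hz : 0 < z) (hρ : 0 < ρ) (h0 : a < ρ)
    (h1 : ρ < a + 1) :
    (logLaplace a z : ℂ) = (1 / (2 * (Real.pi : ℂ))) *
      ∫ t : ℝ, (z : ℂ) ^ (-(ρ + t * Complex.I)) * barnesKernel a (ρ + t * Complex.I) := by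
  have hre (t : ℝ) : (ρ + t * Complex.I : ℂ).re = ρ := by simp
  have hmellin (t : ℝ) := hasMellin_logLaplace (a := a) (w := ρ + t * Complex.I)
    (by rwa [hre]) (by rwa [hre]) (by rwa [hre])
  have hinv := mellinInv_mellin_eq ρ (fun z => (logLaplace a z : ℂ)) hz
    (by simpa using (hmellin 0).1)
    (by simpa only [Complex.VerticalIntegrable, (hmellin _).2] using
      verticalIntegrable_barnesKernel hρ h0 h1)
    (Complex.continuous_ofReal.continuousAt.comp (continuousAt_logLaplace (by linarith) hz))
  rw [← hinv, mellinInv, Complex.real_smul]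
  simp only [(hmellin _).2, smul_eq_mul]
  push_cast
  rfl

theorem meijerIntegrand_gTerm {N : ℕ} {w : ℂ} (hw : (N : ℝ) < w.re) (z : ℂ) :
    meijerIntegrand 3 1 ![-(N : ℂ), 1 - (N : ℂ)] ![0, -(N : ℂ), -(N : ℂ)] z (-w) =
      z ^ (-w) * barnesKernel N w := by
  have hre : 0 < (w - N).re := by simpa using hw
  have hne : w - N ≠ 0 := fun h => by simp [h] at hre
  have hprod : meijerIntegrand 3 1 ![-(N : ℂ), 1 - (N : ℂ)] ![0, -(N : ℂ), -(N : ℂ)] z (-w) =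
      Complex.Gamma w * Complex.Gamma (-N + w) * Complex.Gamma (-N + w) *
        (Complex.Gamma (1 + N + -w) * (Complex.Gamma (1 - N + w))⁻¹) * z ^ (-w) := by
    simp [meijerIntegrand, Fin.prod_univ_succ, mul_assoc]
  rw [hprod, barnesKernel, show 1 + (N : ℂ) + -w = (N : ℝ) - w + 1 by push_cast; ring,
    show -(N : ℂ) + w = w - N by ring, show 1 - (N : ℂ) + w = w - N + 1 by ring,
    Complex.Gamma_add_one _ hne, Complex.ofReal_natCast]
  field_simp

theorem gTerm_eq_logLaplace (N : ℕ) (hz : 0 < z) : gTerm N z = (logLaplace N z : ℂ) := by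
  have hsep : ∃ σ : ℝ, MeijerSeparates 3 1 ![-(N : ℂ), 1 - (N : ℂ)] ![0, -(N : ℂ), -(N : ℂ)] σ :=
    ⟨-N - 1 / 2, (meijerSeparates_gTerm_iff N _).mpr ⟨by linarith, by linarith⟩⟩
  obtain ⟨hσ1, hσ2⟩ := (meijerSeparates_gTerm_iff N _).mp hsep.choose_spec
  rw [gTerm, meijerG, dif_pos hsep]
  generalize hsep.choose = σ at hσ1 hσ2
  rw [logLaplace_eq_integral_barnesKernel (ρ := -σ) hz (by linarith) (by linarith) (by linarith),
    ← integral_neg_eq_self]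
  congr 2 with t
  rw [← meijerIntegrand_gTerm (by simp; linarith)]
  congr 1
  push_cast
  ring

end MeijerLaplace

section GammaLaw

variable {a r : ℝ}

theorem measurable_gammaPDF (a r : ℝ) : Measurable (gammaPDF a r) :=
  (measurable_gammaPDFReal a r).ennreal_ofReal

theorem integral_gammaMeasure {E : Type*} [NormedAddCommGroup E] [NormedSpace ℝ E]
    (ha : 0 < a) (hr : 0 < r) (f : ℝ → E) :
    ∫ x, f x ∂gammaMeasure a r = ∫ x in Ioi 0, gammaPDFReal a r x • f x := by
  rw [gammaMeasure, integral_withDensity_eq_integral_toReal_smul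
    (measurable_gammaPDF a r) (ae_of_all _ fun _ => ENNReal.ofReal_lt_top),
    ← integral_Ici_eq_integral_Ioi, setIntegral_eq_integral_of_forall_compl_eq_zero]
  · simp only [gammaPDF, ENNReal.toReal_ofReal (gammaPDFReal_nonneg ha hr _)]
  · intro x hx
    rw [gammaPDFReal, if_neg (mem_Ici.not.mp hx), zero_smul]

theorem integrable_gammaMeasure_iff {E : Type*} [NormedAddCommGroup E] [NormedSpace ℝ E]
    (ha : 0 < a) (hr : 0 < r) (f : ℝ → E) :
    Integrable f (gammaMeasure a r) ↔
      IntegrableOn (fun x => gammaPDFReal a r x • f x) (Ioi 0) := by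
  rw [gammaMeasure, integrable_withDensity_iff_integrable_smul'
    (measurable_gammaPDF a r) (ae_of_all _ fun _ => ENNReal.ofReal_lt_top),
    ← integrableOn_Ici_iff_integrableOn_Ioi, integrableOn_iff_integrable_of_support_subset]
  · simp only [gammaPDF, ENNReal.toReal_ofReal (gammaPDFReal_nonneg ha hr _)]
  · refine Function.support_subset_iff'.mpr fun x hx => ?_
    rw [gammaPDFReal, if_neg (mem_Ici.not.mp hx), zero_smul]

theorem gammaPDFReal_of_pos (a r : ℝ) {x : ℝ} (hx : 0 < x) :
    gammaPDFReal a r x = r ^ a / Real.Gamma a * (x ^ (a - 1) * Real.exp (-(r * x))) := by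
  rw [gammaPDFReal, if_pos hx.le, mul_assoc]

theorem mgf_gammaMeasure (ha : 0 < a) (hr : 0 < r) (t : ℝ) :
    mgf id (gammaMeasure a r) t = if t < r then (r / (r - t)) ^ a else 0 := by
  have hdensity : ∀ x ∈ Ioi (0 : ℝ), gammaPDFReal a r x • Real.exp (t * x) =
      r ^ a / Real.Gamma a * (x ^ (a - 1) * Real.exp (-((r - t) * x))) := fun x hx => by
    rw [gammaPDFReal_of_pos a r hx, smul_eq_mul, mul_assoc, mul_assoc, ← Real.exp_add]
    congr 4
    ring
  simp only [mgf, id_eq]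
  rw [integral_gammaMeasure ha hr, setIntegral_congr_fun measurableSet_Ioi hdensity,
    integral_const_mul]
  split_ifs with ht
  · rw [Real.integral_rpow_mul_exp_neg_mul_Ioi ha (sub_pos.mpr ht),
      Real.div_rpow hr.le (sub_pos.mpr ht).le, one_div, Real.inv_rpow (sub_pos.mpr ht).le]
    field_simp
  · rw [integral_undef, mul_zero]
    intro hint
    refine not_integrableOn_Ioi_rpow (a - 1) (hint.mono' (by fun_prop) ?_)
    filter_upwards [ae_restrict_mem measurableSet_Ioi] with x (hx : 0 < x)
    rw [Real.norm_of_nonneg (by positivity)]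
    refine le_mul_of_one_le_right (by positivity) (Real.one_le_exp ?_)
    nlinarith

theorem mem_interior_integrableExpSet_gammaMeasure (ha : 0 < a) (hr : 0 < r) :
    0 ∈ interior (integrableExpSet id (gammaMeasure a r)) := by
  refine interior_mono (s := Iio r) (fun t (ht : t < r) => ?_) (by simpa using hr)
  by_contra hint
  have hmgf := mgf_gammaMeasure ha hr t
  rw [mgf_undef hint, if_pos ht] at hmgf
  exact (Real.rpow_pos_of_pos (div_pos hr (sub_pos.mpr ht)) a).ne hmgf

theorem measure_eq_of_mgf_id_eq {ν ν' : Measure ℝ} [IsProbabilityMeasure ν]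
    [IsProbabilityMeasure ν'] (h0 : 0 ∈ interior (integrableExpSet id ν))
    (h : mgf id ν = mgf id ν') : ν = ν' :=
  Measure.ext_of_charFun <| funext fun t => by
    rw [← complexMGF_id_mul_I, ← complexMGF_id_mul_I]
    exact eqOn_complexMGF_of_mgf h (by simpa using h0)

theorem hasLaw_gammaMeasure_of_mgf {S : Type*} [MeasurableSpace S] {μ : Measure S}
    [IsProbabilityMeasure μ] (ha : 0 < a) (hr : 0 < r) {X : S → ℝ} (hX : AEMeasurable X μ)
    (hmgf : ∀ t, mgf X μ t = if t < r then (r / (r - t)) ^ a else 0) :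
    HasLaw X (gammaMeasure a r) μ := by
  have := isProbabilityMeasure_gammaMeasure ha hr
  have := Measure.isProbabilityMeasure_map hX
  refine ⟨hX, (measure_eq_of_mgf_id_eq (mem_interior_integrableExpSet_gammaMeasure ha hr)
    (funext fun t => ?_)).symm⟩
  rw [mgf_gammaMeasure ha hr, mgf_id_map hX, hmgf]

theorem hasLaw_sum_gammaMeasure {S ι : Type*} [MeasurableSpace S] {μ : Measure S} [Fintype ι]
    [Nonempty ι] {a : ι → ℝ} (ha : ∀ i, 0 < a i) (hr : 0 < r) {X : ι → S → ℝ}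
    (law : ∀ i, HasLaw (X i) (gammaMeasure (a i) r) μ) (hindep : iIndepFun X μ) :
    HasLaw (fun ω => ∑ i, X i ω) (gammaMeasure (∑ i, a i) r) μ := by
  have := hindep.isProbabilityMeasure
  have haem : ∀ i, AEMeasurable (X i) μ := fun i => (law i).aemeasurable
  refine hasLaw_gammaMeasure_of_mgf (Finset.sum_pos (fun i _ => ha i) Finset.univ_nonempty) hr
    (by fun_prop) fun t => ?_
  have hmgf : ∀ i, mgf (X i) μ t = if t < r then (r / (r - t)) ^ a i else 0 := fun i => by
    rw [← mgf_id_map (haem i), (law i).map_eq, mgf_gammaMeasure (ha i) hr]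
  rw [← Finset.sum_fn, hindep.mgf_sum₀ haem, Finset.prod_congr rfl fun i _ => hmgf i]
  split_ifs with ht
  · rw [Real.rpow_sum_of_pos (div_pos hr (sub_pos.mpr ht))]
  · exact Finset.prod_eq_zero (Finset.mem_univ (Classical.arbitrary ι)) rfl

end GammaLaw

section Gains

theorem mgf_sq_gaussianReal {v : NNReal} (hv : v ≠ 0) (t : ℝ) :
    mgf (fun x => x ^ 2) (gaussianReal 0 v) t = √((1 - 2 * v * t)⁻¹) := by
  have hdensity : ∀ x : ℝ, gaussianPDFReal 0 v x • Real.exp (t * x ^ 2) =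
      (√(2 * Real.pi * v))⁻¹ * Real.exp (-(1 / (2 * v) - t) * x ^ 2) := fun x => by
    rw [gaussianPDFReal, smul_eq_mul, mul_assoc, ← Real.exp_add]
    congr 2
    ring
  rw [mgf, integral_gaussianReal_eq_integral_smul hv]
  simp only [hdensity]
  rw [integral_const_mul, integral_gaussian, ← Real.sqrt_inv, ← Real.sqrt_mul (by positivity)]
  congr 1
  rw [show 1 / (2 * (v : ℝ)) - t = (1 - 2 * v * t) / (2 * v) by field_simp]
  field_simp

theorem mgf_normSq_complexNormal {v : ℝ} (hv : 0 < v) (t : ℝ) :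
    mgf (fun z => ‖z‖ ^ 2) (complexNormal v) t =
      if t < v⁻¹ then (v⁻¹ / (v⁻¹ - t)) ^ (1 : ℝ) else 0 := by
  have hsplit : ∀ p : ℝ × ℝ, Real.exp (t * ‖Complex.measurableEquivRealProd.symm p‖ ^ 2) =
      Real.exp (t * p.1 ^ 2) * Real.exp (t * p.2 ^ 2) := fun p => by
    rw [← Real.exp_add, ← Complex.normSq_eq_norm_sq, Complex.normSq_apply]
    simp only [Complex.measurableEquivRealProd_symm_apply]
    congr 1
    ring
  have hmgf := mgf_sq_gaussianReal (v := (v / 2).toNNReal) (by simpa using hv) t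
  rw [Real.coe_toNNReal _ (by positivity), mul_div_cancel₀ v two_ne_zero, mgf] at hmgf
  rw [mgf, complexNormal, integral_map_equiv]
  simp only [hsplit]
  rw [integral_prod_mul (fun x : ℝ => Real.exp (t * x ^ 2)) (fun x : ℝ => Real.exp (t * x ^ 2)),
    hmgf, Real.rpow_one]
  split_ifs with ht
  · have hpos : 0 < 1 - v * t := by
      have := mul_lt_mul_of_pos_left ht hv
      rw [mul_inv_cancel₀ hv.ne'] at this
      linarith
    rw [Real.mul_self_sqrt (by positivity)]
    field_simp
  · have hneg : (1 - v * t)⁻¹ ≤ 0 := by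
      have := mul_le_mul_of_nonneg_left (not_lt.mp ht) hv.le
      rw [mul_inv_cancel₀ hv.ne'] at this
      exact inv_nonpos.mpr (by linarith)
    rw [Real.sqrt_eq_zero_of_nonpos hneg, mul_zero]

instance isProbabilityMeasure_complexNormal (v : ℝ) : IsProbabilityMeasure (complexNormal v) :=
  Measure.isProbabilityMeasure_map (by fun_prop)

theorem hasLaw_normSq_complexNormal {v : ℝ} (hv : 0 < v) :
    HasLaw (fun z : ℂ => ‖z‖ ^ 2) (expMeasure v⁻¹) (complexNormal v) :=
  hasLaw_gammaMeasure_of_mgf one_pos (inv_pos.mpr hv) (by fun_prop) (mgf_normSq_complexNormal hv)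

theorem hasLaw_mrcGain {S : Type*} [MeasurableSpace S] {μ : Measure S} {N : ℕ} (hN : 1 ≤ N)
    {v : ℝ} (hv : 0 < v) {h : Fin N → S → ℂ} (law : ∀ i, HasLaw (h i) (complexNormal v) μ)
    (hindep : iIndepFun h μ) :
    HasLaw (fun ω => mrcGain fun i => h i ω) (gammaMeasure N v⁻¹) μ := by
  have : Nonempty (Fin N) := ⟨⟨0, hN⟩⟩
  have hsum := hasLaw_sum_gammaMeasure (fun _ : Fin N => one_pos) (inv_pos.mpr hv)
    (fun i => (hasLaw_normSq_complexNormal hv).fun_comp (law i))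
    (hindep.comp (fun _ z => ‖z‖ ^ 2) fun _ => by fun_prop)
  simpa only [mrcGain, Finset.sum_const, Finset.card_univ, Fintype.card_fin, nsmul_eq_mul, mul_one]
    using hsum

end Gains

section ErlangTail

/-- The probability `exp (-(r x)) * ∑ k < n, (r x) ^ k / k!` that a Poisson process of rate `r` has
fewer than `n` points in `[0, x]`; for `n ≥ 1` and `x ≥ 0` it is the upper tail at `x` of the gamma
law with shape `n` and rate `r`. -/
def erlangTail (n : ℕ) (r x : ℝ) : ℝ :=
  Real.exp (-(r * x)) * ∑ k ∈ Finset.range n, (r * x) ^ k / k.factorial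

theorem hasDerivAt_sum_pow_div_factorial (m : ℕ) (x : ℝ) :
    HasDerivAt (fun x : ℝ => ∑ k ∈ Finset.range (m + 1), x ^ k / k.factorial)
      (∑ k ∈ Finset.range m, x ^ k / k.factorial) x := by
  simp only [Finset.sum_range_succ', pow_zero]
  refine (HasDerivAt.fun_sum fun k _ => ?_).add_const _
  refine ((hasDerivAt_pow (k + 1) x).div_const ((k + 1).factorial : ℝ)).congr_deriv ?_
  rw [Nat.factorial_succ, Nat.add_sub_cancel]
  push_cast
  field_simp

theorem hasDerivAt_erlangTail (m : ℕ) (r x : ℝ) :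
    HasDerivAt (erlangTail (m + 1) r)
      (-(r ^ (m + 1) / m.factorial * (x ^ m * Real.exp (-(r * x))))) x := by
  have hr : HasDerivAt (fun x => r * x) r x := by simpa using (hasDerivAt_id x).const_mul r
  refine (hr.neg.exp.mul
    ((hasDerivAt_sum_pow_div_factorial m (r * x)).comp x hr)).congr_deriv ?_
  simp only [Function.comp_apply, Pi.neg_apply, Finset.sum_range_succ]
  ring

theorem tendsto_erlangTail_atTop (n : ℕ) {r : ℝ} (hr : 0 < r) :
    Tendsto (erlangTail n r) atTop (𝓝 0) := by
  have hterm (k : ℕ) : Tendsto (fun y : ℝ => y ^ k * Real.exp (-y) / k.factorial) atTop (𝓝 0) := by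
    simpa using (Real.tendsto_pow_mul_exp_neg_atTop_nhds_zero k).div_const (k.factorial : ℝ)
  have hsum := (tendsto_finsetSum (Finset.range n) fun k _ => hterm k).comp
    (tendsto_id.const_mul_atTop hr)
  rw [Finset.sum_const_zero] at hsum
  refine hsum.congr fun x => ?_
  rw [erlangTail, Finset.mul_sum]
  exact Finset.sum_congr rfl fun k _ => by simp only [id_eq]; ring

theorem measureReal_gammaMeasure_Ioi {n : ℕ} (hn : 1 ≤ n) {r x : ℝ} (hr : 0 < r) (hx : 0 ≤ x) :
    (gammaMeasure n r).real (Ioi x) = erlangTail n r x := by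
  obtain ⟨m, rfl⟩ := Nat.exists_eq_add_of_le' hn
  have hdensity : ∀ y ∈ Ioi x, gammaPDFReal ((m + 1 : ℕ) : ℝ) r y =
      r ^ (m + 1) / m.factorial * (y ^ m * Real.exp (-(r * y))) := fun y hy => by
    rw [gammaPDFReal_of_pos _ r (hx.trans_lt hy), Nat.cast_succ, Real.Gamma_nat_eq_factorial,
      add_sub_cancel_right, Real.rpow_natCast, ← Nat.cast_succ, Real.rpow_natCast]
  have htail := integral_Ioi_of_hasDerivAt_of_nonpos'
    (fun y _ => hasDerivAt_erlangTail m r y)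
    (fun y hy => neg_nonpos.mpr (by have := hx.trans_lt hy; positivity))
    (tendsto_erlangTail_atTop (m + 1) hr)
  rw [integral_neg, zero_sub, neg_inj] at htail
  have hIoi : ∫ y in Ioi x, gammaPDFReal ((m + 1 : ℕ) : ℝ) r y =
      ∫ y in Ioi 0, (Ioi x).indicator (gammaPDFReal ((m + 1 : ℕ) : ℝ) r) y := by
    rw [setIntegral_indicator measurableSet_Ioi,
      inter_eq_self_of_subset_right (Ioi_subset_Ioi hx)]
  rw [← integral_indicator_one measurableSet_Ioi, integral_gammaMeasure (by positivity) hr,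
    ← htail, ← setIntegral_congr_fun measurableSet_Ioi hdensity, hIoi]
  simp only [indicator_apply, Pi.one_apply, smul_eq_mul, mul_ite, mul_one, mul_zero]

theorem measureReal_gammaMeasure_Ici {n : ℕ} (hn : 1 ≤ n) {r x : ℝ} (hr : 0 < r) (hx : 0 ≤ x) :
    (gammaMeasure n r).real (Ici x) = erlangTail n r x := by
  rw [← measureReal_gammaMeasure_Ioi hn hr hx]
  exact measureReal_congr ((withDensity_absolutelyContinuous _ _).ae_eq Ioi_ae_eq_Ici).symm

end ErlangTail

section Min

theorem comp_min_eq_indicator_add {α E : Type*} [LinearOrder α] [AddZeroClass E] (h : α → E) :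
    (fun p : α × α => h (min p.1 p.2)) =
      {p | p.1 ≤ p.2}.indicator (fun p => h p.1) + {p | p.2 < p.1}.indicator fun p => h p.2 := by
  funext p
  rcases le_or_gt p.1 p.2 with hp | hp
  · simp [hp, hp.not_gt]
  · simp [hp, hp.not_ge, min_eq_right hp.le]

variable {α E : Type*} [LinearOrder α] [TopologicalSpace α] [OrderClosedTopology α]
  [SecondCountableTopology α] [MeasurableSpace α] [OpensMeasurableSpace α]
  [NormedAddCommGroup E] {μ ν : Measure α} [IsFiniteMeasure μ] [IsFiniteMeasure ν] {h : α → E}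

theorem integrable_comp_min (hμ : Integrable h μ) (hν : Integrable h ν) :
    Integrable (fun p : α × α => h (min p.1 p.2)) (μ.prod ν) := by
  rw [comp_min_eq_indicator_add]
  exact ((hμ.comp_fst ν).indicator (measurableSet_le measurable_fst measurable_snd)).add
    ((hν.comp_snd μ).indicator (measurableSet_lt measurable_snd measurable_fst))

theorem integral_comp_min [NormedSpace ℝ E] [CompleteSpace E] (hμ : Integrable h μ)
    (hν : Integrable h ν) :
    ∫ p : α × α, h (min p.1 p.2) ∂μ.prod ν =
      ∫ x, ν.real (Ici x) • h x ∂μ + ∫ y, μ.real (Ioi y) • h y ∂ν := by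
  have hle := (hμ.comp_fst ν).indicator (measurableSet_le measurable_fst measurable_snd)
  have hlt := (hν.comp_snd μ).indicator (measurableSet_lt measurable_snd measurable_fst)
  rw [comp_min_eq_indicator_add, integral_add' hle hlt, integral_prod _ hle,
    integral_prod_symm _ hlt]
  congr 1
  · refine integral_congr_ae (ae_of_all _ fun x => ?_)
    exact integral_indicator_const (h x) measurableSet_Ici
  · refine integral_congr_ae (ae_of_all _ fun y => ?_)
    exact integral_indicator_const (h y) measurableSet_Ioi

end Min

section ErlangTilt

variable {a r s : ℝ} {m : ℕ}

theorem gammaPDFReal_mul_erlangTail (ha : 0 < a) (hr : 0 < r) (hs : 0 < s) (m : ℕ) {x : ℝ}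
    (hx : 0 < x) :
    gammaPDFReal a r x * erlangTail m s x = ∑ k ∈ Finset.range m,
      r ^ a / Real.Gamma a * (s ^ k / k.factorial) * (Real.Gamma (a + k) / (r + s) ^ (a + k)) *
        gammaPDFReal (a + k) (r + s) x := by
  rw [erlangTail, ← mul_assoc, Finset.mul_sum]
  refine Finset.sum_congr rfl fun k _ => ?_
  rw [gammaPDFReal_of_pos _ _ hx, gammaPDFReal_of_pos _ _ hx, add_mul, neg_add, Real.exp_add,
    add_sub_right_comm, Real.rpow_add_natCast hx.ne', mul_pow]
  field_simp

variable {E : Type*} [NormedAddCommGroup E] [NormedSpace ℝ E] {f : ℝ → E}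

theorem integral_erlangTail_smul (ha : 0 < a) (hr : 0 < r) (hs : 0 < s)
    (hf : ∀ k < m, Integrable f (gammaMeasure (a + k) (r + s))) :
    ∫ x, erlangTail m s x • f x ∂gammaMeasure a r = ∑ k ∈ Finset.range m,
      (r ^ a / Real.Gamma a * (s ^ k / k.factorial) *
        (Real.Gamma (a + k) / (r + s) ^ (a + k))) • ∫ x, f x ∂gammaMeasure (a + k) (r + s) := by
  have hsplit : ∀ x ∈ Ioi (0 : ℝ), gammaPDFReal a r x • erlangTail m s x • f x =
      ∑ k ∈ Finset.range m, (r ^ a / Real.Gamma a * (s ^ k / k.factorial) *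
        (Real.Gamma (a + k) / (r + s) ^ (a + k))) • gammaPDFReal (a + k) (r + s) x • f x :=
    fun x hx => by
      rw [smul_smul, gammaPDFReal_mul_erlangTail ha hr hs m hx, Finset.sum_smul]
      simp only [mul_smul]
  rw [integral_gammaMeasure ha hr, setIntegral_congr_fun measurableSet_Ioi hsplit,
    integral_finsetSum]
  · refine Finset.sum_congr rfl fun k _ => ?_
    rw [integral_smul, integral_gammaMeasure (by positivity) (by positivity)]
  · intro k hk
    exact ((integrable_gammaMeasure_iff (by positivity) (by positivity) f).mp
      (hf k (Finset.mem_range.mp hk))).smul _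

theorem integral_comp_min_gammaMeasure [CompleteSpace E] {n m : ℕ} (hn : 1 ≤ n) (hm : 1 ≤ m)
    (hr : 0 < r) (hs : 0 < s) (hfr : Integrable f (gammaMeasure n r))
    (hfs : Integrable f (gammaMeasure m s)) :
    ∫ p : ℝ × ℝ, f (min p.1 p.2) ∂(gammaMeasure n r).prod (gammaMeasure m s) =
      ∫ x, erlangTail m s x • f x ∂gammaMeasure n r +
        ∫ y, erlangTail n r y • f y ∂gammaMeasure m s := by
  have hn' : (0 : ℝ) < n := by positivity
  have hm' : (0 : ℝ) < m := by positivity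
  have := isProbabilityMeasure_gammaMeasure hn' hr
  have := isProbabilityMeasure_gammaMeasure hm' hs
  rw [integral_comp_min hfr hfs]
  simp only [integral_gammaMeasure hn' hr, integral_gammaMeasure hm' hs]
  congr 1
  · refine setIntegral_congr_fun measurableSet_Ioi fun x (hx : 0 < x) => ?_
    simp only [measureReal_gammaMeasure_Ici hm hs hx.le]
  · refine setIntegral_congr_fun measurableSet_Ioi fun y (hy : 0 < y) => ?_
    simp only [measureReal_gammaMeasure_Ioi hn hr hy.le]

end ErlangTilt

section LogAverages

variable {a r c : ℝ}

theorem eqOn_gammaPDFReal_smul_log_one_add (a r : ℝ) (hc : 0 < c) :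
    EqOn (fun x => gammaPDFReal a r x • Real.log (1 + c * x))
      (fun x => c * (r ^ a / (Real.Gamma a * c ^ a)) *
        (Real.log (1 + c * x) * (c * x) ^ (a - 1) * Real.exp (-(r / c * (c * x))))) (Ioi 0) := by
  intro x (hx : 0 < x)
  beta_reduce
  rw [gammaPDFReal_of_pos a r hx, Real.mul_rpow hc.le hx.le, Real.rpow_sub_one hc.ne', smul_eq_mul,
    show r / c * (c * x) = r * x by field_simp]
  field_simp

theorem integrable_log_one_add_gammaMeasure (ha : 0 < a) (hc : 0 < c) (hr : 0 < r) :
    Integrable (fun x => Real.log (1 + c * x)) (gammaMeasure a r) := by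
  rw [integrable_gammaMeasure_iff ha hr, integrableOn_congr_fun
    (eqOn_gammaPDFReal_smul_log_one_add a r hc) measurableSet_Ioi]
  refine Integrable.const_mul ((integrableOn_Ioi_comp_mul_left_iff
    (fun y => Real.log (1 + y) * y ^ (a - 1) * Real.exp (-(r / c * y))) 0 hc).mpr ?_) _
  rw [mul_zero]
  exact integrableOn_log_one_add_mul_rpow_mul_exp (by linarith) (div_pos hr hc)

theorem integral_log_one_add_gammaMeasure (ha : 0 < a) (hc : 0 < c) (hr : 0 < r) :
    ∫ x, Real.log (1 + c * x) ∂gammaMeasure a r =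
      r ^ a / (Real.Gamma a * c ^ a) * logLaplace a (r / c) := by
  rw [integral_gammaMeasure ha hr, setIntegral_congr_fun measurableSet_Ioi
      (eqOn_gammaPDFReal_smul_log_one_add a r hc), integral_const_mul,
    integral_comp_mul_left_Ioi
      (fun y => Real.log (1 + y) * y ^ (a - 1) * Real.exp (-(r / c * y))) 0 hc,
    mul_zero, ← logLaplace, smul_eq_mul]
  field_simp

theorem integral_log_one_add_gammaMeasure_eq_gTerm {n : ℕ} (hn : 1 ≤ n) (hc : 0 < c) {v : ℝ}
    (hv : 0 < v) :
    ((∫ x, Real.log (1 + c * x) ∂gammaMeasure n v⁻¹ : ℝ) : ℂ) =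
      1 / (Complex.Gamma n * (v : ℂ) ^ n * (c : ℂ) ^ n) * gTerm n (1 / (v * c)) := by
  rw [integral_log_one_add_gammaMeasure (by positivity) hc (inv_pos.mpr hv),
    gTerm_eq_logLaplace n (by positivity), Real.rpow_natCast, Real.rpow_natCast,
    show v⁻¹ / c = 1 / (v * c) by field_simp]
  push_cast [← Complex.Gamma_ofReal]
  rw [inv_pow]
  field_simp

/-- The rate `log (1 + P g) - log (1 + an P g)`, in nats, at which the far user's symbol can be
decoded at a receiver with channel gain `g` when the transmit power is `P`. -/
def farNatRate (an P g : ℝ) : ℝ :=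
  Real.log (1 + P * g) - Real.log (1 + an * P * g)

variable {an P : ℝ}

theorem integrable_farNatRate (han : 0 < an) (hP : 0 < P) (ha : 0 < a) (hr : 0 < r) :
    Integrable (farNatRate an P) (gammaMeasure a r) :=
  (integrable_log_one_add_gammaMeasure ha hP hr).sub
    (integrable_log_one_add_gammaMeasure ha (mul_pos han hP) hr)

theorem integral_farNatRate {n : ℕ} (hn : 1 ≤ n) (han : 0 < an) (hP : 0 < P) {v : ℝ}
    (hv : 0 < v) :
    ((∫ x, farNatRate an P x ∂gammaMeasure n v⁻¹ : ℝ) : ℂ) =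
      1 / (Complex.Gamma n * (v : ℂ) ^ n * (P : ℂ) ^ n) *
        (gTerm n (1 / (v * P)) - 1 / (an : ℂ) ^ n * gTerm n (1 / (v * an * P))) := by
  have hn' : (0 : ℝ) < n := by positivity
  simp only [farNatRate]
  rw [integral_sub (integrable_log_one_add_gammaMeasure hn' hP (inv_pos.mpr hv))
      (integrable_log_one_add_gammaMeasure hn' (mul_pos han hP) (inv_pos.mpr hv)),
    Complex.ofReal_sub, integral_log_one_add_gammaMeasure_eq_gTerm hn hP hv,
    integral_log_one_add_gammaMeasure_eq_gTerm hn (mul_pos han hP) hv, Complex.ofReal_mul,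
    mul_pow, ← mul_assoc v]
  field_simp

theorem integral_erlangTail_smul_farNatRate {n : ℕ} (hn : 1 ≤ n) (m : ℕ) (han : 0 < an)
    (hP : 0 < P) {v w Ω : ℝ} (hv : 0 < v) (hw : 0 < w) (hΩ : Ω⁻¹ = v⁻¹ + w⁻¹) :
    ((∫ x, erlangTail m w⁻¹ x • farNatRate an P x ∂gammaMeasure n v⁻¹ : ℝ) : ℂ) =
      1 / (Complex.Gamma n * (v : ℂ) ^ n) * ∑ k ∈ Finset.range m,
        1 / ((k.factorial : ℂ) * (w : ℂ) ^ k * (P : ℂ) ^ (n + k)) *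
          (gTerm (n + k) (1 / (Ω * P)) -
            1 / (an : ℂ) ^ (n + k) * gTerm (n + k) (1 / (Ω * an * P))) := by
  have hn' : (0 : ℝ) < n := by positivity
  have hr := inv_pos.mpr hv
  have hs := inv_pos.mpr hw
  have hΩ0 : 0 < Ω := inv_pos.mp (hΩ ▸ add_pos hr hs)
  have hΩc : (Ω : ℂ) ≠ 0 := Complex.ofReal_ne_zero.mpr hΩ0.ne'
  rw [integral_erlangTail_smul hn' hr hs fun k _ =>
      integrable_farNatRate han hP (by positivity) (add_pos hr hs),
    Complex.ofReal_sum, Finset.mul_sum]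
  refine Finset.sum_congr rfl fun k _ => ?_
  have hΓ : (Real.Gamma (n + k) : ℂ) ≠ 0 :=
    Complex.ofReal_ne_zero.mpr (Real.Gamma_pos_of_pos (by positivity)).ne'
  rw [← hΩ, ← Nat.cast_add, smul_eq_mul, Complex.ofReal_mul,
    integral_farNatRate (hn.trans (Nat.le_add_right n k)) han hP hΩ0]
  simp only [Real.rpow_natCast, inv_pow]
  rw [← Complex.ofReal_natCast (n + k), ← Complex.ofReal_natCast n, Complex.Gamma_ofReal,
    Complex.Gamma_ofReal]
  push_cast
  field_simp

end LogAverages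

section Rates

variable {an af P g : ℝ}

theorem mrcGain_nonneg {N : ℕ} (h : Fin N → ℂ) : 0 ≤ mrcGain h :=
  Finset.sum_nonneg fun _ _ => sq_nonneg _

theorem oneBitPower_nonneg {I Ppeak : ℝ} (hP : 0 ≤ Ppeak) (gp : ℝ) :
    0 ≤ oneBitPower I Ppeak gp := by
  unfold oneBitPower
  split_ifs
  exacts [hP, le_rfl]

theorem one_add_sinrFar (han : 0 ≤ an) (hsum : an + af = 1) (hP : 0 ≤ P) (hg : 0 ≤ g) :
    1 + sinrFar an af P g = (1 + P * g) / (1 + an * P * g) := by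
  obtain rfl : af = 1 - an := by linarith
  rw [sinrFar]
  field_simp
  ring

theorem logb_one_add_sinrFar (han : 0 ≤ an) (hsum : an + af = 1) (hP : 0 ≤ P) (hg : 0 ≤ g) :
    Real.logb 2 (1 + sinrFar an af P g) =
      Real.logb 2 (1 + P * g) - Real.logb 2 (1 + an * P * g) := by
  rw [one_add_sinrFar han hsum hP hg, Real.logb_div (by positivity) (by positivity)]

theorem monotoneOn_logb_one_add_sinrFar (han : 0 ≤ an) (haf : 0 ≤ af) (hP : 0 ≤ P) :
    MonotoneOn (fun g => Real.logb 2 (1 + sinrFar an af P g)) (Ici 0) := by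
  intro x (hx : 0 ≤ x) y (hy : 0 ≤ y) hxy
  have hsinr : sinrFar an af P x ≤ sinrFar an af P y := by
    unfold sinrFar
    rw [div_le_div_iff₀ (by positivity) (by positivity)]
    linarith [mul_le_mul_of_nonneg_left hxy (mul_nonneg haf hP)]
  refine Real.logb_le_logb_of_le one_lt_two ?_ (by linarith)
  unfold sinrFar
  positivity

theorem min_logb_one_add_sinrFar (han : 0 ≤ an) (haf : 0 ≤ af) (hsum : an + af = 1) (hP : 0 ≤ P)
    {x y : ℝ} (hx : 0 ≤ x) (hy : 0 ≤ y) :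
    min (Real.logb 2 (1 + sinrFar an af P x)) (Real.logb 2 (1 + sinrFar an af P y)) =
      Real.logb 2 (1 + P * min x y) - Real.logb 2 (1 + an * P * min x y) := by
  rw [← logb_one_add_sinrFar han hsum hP (le_min hx hy)]
  exact ((monotoneOn_logb_one_add_sinrFar han haf hP).map_min hx hy).symm

theorem oneBitSumRate_eq_oneBitSumRateMin (han : 0 ≤ an) (haf : 0 ≤ af) (hsum : an + af = 1)
    (I : ℝ) {Ppeak : ℝ} (hPpeak : 0 ≤ Ppeak) {Nn Nf : ℕ} (hp : ℂ) (hn : Fin Nn → ℂ)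
    (hf : Fin Nf → ℂ) :
    oneBitSumRate an af I Ppeak hp hn hf = oneBitSumRateMin an I Ppeak hp hn hf := by
  rw [oneBitSumRate, sumRate, min_logb_one_add_sinrFar han haf hsum
    (oneBitPower_nonneg hPpeak _) (mrcGain_nonneg hn) (mrcGain_nonneg hf), oneBitSumRateMin,
    snrNear, mul_right_comm, add_sub_assoc]

/-- The NOMA sum-rate in nats at constant transmit power `P`, as a function of the channel gains
`p = (gn, gf)` of the near and the far user. -/
def natSumRate (an P : ℝ) (p : ℝ × ℝ) : ℝ :=
  Real.log (1 + an * P * p.1) + farNatRate an P (min p.1 p.2)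

theorem measurable_natSumRate (an P : ℝ) : Measurable (natSumRate an P) := by
  unfold natSumRate farNatRate
  fun_prop

theorem oneBitSumRateMin_eq_indicator_mul_natSumRate (an I Ppeak : ℝ) {Nn Nf : ℕ} (hp : ℂ)
    (hn : Fin Nn → ℂ) (hf : Fin Nf → ℂ) :
    oneBitSumRateMin an I Ppeak hp hn hf =
      (Iic (I / Ppeak)).indicator (fun _ => (Real.log 2)⁻¹) (‖hp‖ ^ 2) *
        natSumRate an Ppeak (mrcGain hn, mrcGain hf) := by
  by_cases h : ‖hp‖ ^ 2 ≤ I / Ppeak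
  · rw [indicator_of_mem (mem_Iic.mpr h)]
    simp only [oneBitSumRateMin, oneBitPower, if_pos h, natSumRate, farNatRate, Real.logb]
    ring
  · rw [indicator_of_notMem (mem_Iic.not.mpr h)]
    simp only [oneBitSumRateMin, oneBitPower, if_neg h, mul_zero, zero_mul, add_zero,
      Real.logb_one, sub_zero]

theorem integrable_natSumRate {n m r s : ℝ} (hn : 0 < n) (hm : 0 < m) (hr : 0 < r) (hs : 0 < s)
    (han : 0 < an) (hP : 0 < P) :
    Integrable (natSumRate an P) ((gammaMeasure n r).prod (gammaMeasure m s)) := by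
  have := isProbabilityMeasure_gammaMeasure hn hr
  have := isProbabilityMeasure_gammaMeasure hm hs
  exact ((integrable_log_one_add_gammaMeasure hn (mul_pos han hP) hr).comp_fst _).add
    (integrable_comp_min (integrable_farNatRate han hP hn hr) (integrable_farNatRate han hP hm hs))

theorem integral_natSumRate {n m : ℕ} (hn : 1 ≤ n) (hm : 1 ≤ m) {v w Ω : ℝ} (hv : 0 < v)
    (hw : 0 < w) (hΩ : Ω⁻¹ = v⁻¹ + w⁻¹) (han : 0 < an) (hP : 0 < P) :
    ((∫ p, natSumRate an P p ∂(gammaMeasure n v⁻¹).prod (gammaMeasure m w⁻¹) : ℝ) : ℂ) =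
      1 / (Complex.Gamma n * (v : ℂ) ^ n * ((an : ℂ) * P) ^ n) * gTerm n (1 / (v * an * P)) +
      1 / (Complex.Gamma n * (v : ℂ) ^ n) * ∑ k ∈ Finset.range m,
        1 / ((k.factorial : ℂ) * (w : ℂ) ^ k * (P : ℂ) ^ (n + k)) *
          (gTerm (n + k) (1 / (Ω * P)) -
            1 / (an : ℂ) ^ (n + k) * gTerm (n + k) (1 / (Ω * an * P))) +
      1 / (Complex.Gamma m * (w : ℂ) ^ m) * ∑ l ∈ Finset.range n,
        1 / ((l.factorial : ℂ) * (v : ℂ) ^ l * (P : ℂ) ^ (m + l)) *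
          (gTerm (m + l) (1 / (Ω * P)) -
            1 / (an : ℂ) ^ (m + l) * gTerm (m + l) (1 / (Ω * an * P))) := by
  have hr := inv_pos.mpr hv
  have hs := inv_pos.mpr hw
  have hn' : (0 : ℝ) < n := by positivity
  have hm' : (0 : ℝ) < m := by positivity
  have hprobn := isProbabilityMeasure_gammaMeasure hn' hr
  have hprobm := isProbabilityMeasure_gammaMeasure hm' hs
  have hnear := integrable_log_one_add_gammaMeasure hn' (mul_pos han hP) hr
  have hfarn := integrable_farNatRate han hP hn' hr
  have hfarm := integrable_farNatRate han hP hm' hs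
  simp only [natSumRate]
  rw [integral_add (hnear.comp_fst _) (integrable_comp_min hfarn hfarm),
    integral_fun_fst (fun x => Real.log (1 + an * P * x)), probReal_univ, one_smul,
    integral_comp_min_gammaMeasure hn hm hr hs hfarn hfarm, Complex.ofReal_add, Complex.ofReal_add,
    integral_log_one_add_gammaMeasure_eq_gTerm hn (mul_pos han hP) hv,
    integral_erlangTail_smul_farNatRate hn m han hP hv hw hΩ,
    integral_erlangTail_smul_farNatRate hm n han hP hw hv (hΩ.trans (add_comm _ _)),
    Complex.ofReal_mul, ← mul_assoc v, add_assoc]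

end Rates

section Channel

variable {S : Type*} [MeasurableSpace S] {μ : Measure S}

theorem indepFun_of_iIndepFun_sumElim {ι κ E : Type*} [Finite ι] [Finite κ] [MeasurableSpace E]
    {f : ι → S → E} {g : κ → S → E} (hf : ∀ i, AEMeasurable (f i) μ)
    (hg : ∀ j, AEMeasurable (g j) μ) (hindep : iIndepFun (Sum.elim f g) μ) :
    IndepFun (fun ω i => f i ω) (fun ω j => g j ω) μ := by
  classical
  have := Fintype.ofFinite ι
  have := Fintype.ofFinite κ
  have hdisj : Disjoint ((Finset.univ : Finset ι).map Function.Embedding.inl)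
      ((Finset.univ : Finset κ).map Function.Embedding.inr) :=
    Finset.disjoint_map_inl_map_inr _ _
  have hfinset := hindep.indepFun_finset₀ _ _ hdisj (Sum.rec hf hg)
  exact hfinset.comp (φ := fun x i => x ⟨Sum.inl i, by simp⟩)
    (ψ := fun y j => y ⟨Sum.inr j, by simp⟩) (measurable_pi_lambda _ fun _ => measurable_pi_apply _)
    (measurable_pi_lambda _ fun _ => measurable_pi_apply _)

variable {Nn Nf : ℕ} {Ωp Ωn Ωf : ℝ} {hp : S → ℂ} {hn : Fin Nn → S → ℂ} {hf : Fin Nf → S → ℂ}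

theorem hasLaw_gains (hNn : 1 ≤ Nn) (hNf : 1 ≤ Nf) (hΩp : 0 < Ωp) (hΩn : 0 < Ωn) (hΩf : 0 < Ωf)
    (lawp : HasLaw hp (complexNormal Ωp) μ) (lawn : ∀ i, HasLaw (hn i) (complexNormal Ωn) μ)
    (lawf : ∀ j, HasLaw (hf j) (complexNormal Ωf) μ)
    (hindep : iIndepFun (Sum.elim (fun _ : Unit => hp) (Sum.elim hn hf)) μ) :
    HasLaw (fun ω => (‖hp ω‖ ^ 2, mrcGain fun i => hn i ω, mrcGain fun j => hf j ω))
      ((expMeasure Ωp⁻¹).prod ((gammaMeasure Nn Ωn⁻¹).prod (gammaMeasure Nf Ωf⁻¹))) μ := by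
  have := hindep.isProbabilityMeasure
  have hnm i := (lawn i).aemeasurable
  have hfm j := (lawf j).aemeasurable
  have hindep_nf : iIndepFun (Sum.elim hn hf) μ := hindep.precomp (g := Sum.inr) Sum.inr_injective
  have hgain {N : ℕ} : Measurable fun h : Fin N → ℂ => mrcGain h := by
    unfold mrcGain
    fun_prop
  have hlaw_n := hasLaw_mrcGain hNn hΩn lawn
    (hindep_nf.precomp (g := Sum.inl) Sum.inl_injective)
  have hlaw_f := hasLaw_mrcGain hNf hΩf lawf
    (hindep_nf.precomp (g := Sum.inr) Sum.inr_injective)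
  have hlaw_nf := ((indepFun_of_iIndepFun_sumElim hnm hfm hindep_nf).comp hgain
    hgain).hasLaw_prod hlaw_n hlaw_f
  have hindep_p := (indepFun_of_iIndepFun_sumElim (fun _ => lawp.aemeasurable)
    (Sum.rec hnm hfm) hindep).comp (φ := fun x => ‖x ()‖ ^ 2)
    (ψ := fun y => (mrcGain fun i => y (Sum.inl i), mrcGain fun j => y (Sum.inr j)))
    (by fun_prop) (by fun_prop)
  exact hindep_p.hasLaw_prod ((hasLaw_normSq_complexNormal hΩp).fun_comp lawp) hlaw_nf

theorem measureReal_expMeasure_Iic {r x : ℝ} (hr : 0 < r) (hx : 0 ≤ x) :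
    (expMeasure r).real (Iic x) = 1 - Real.exp (-(r * x)) := by
  have := isProbabilityMeasure_expMeasure hr
  rw [← cdf_eq_real, cdf_expMeasure_eq hr, if_pos hx]

theorem integrable_oneBitSumRateMin (hNn : 1 ≤ Nn) (hNf : 1 ≤ Nf) (hΩp : 0 < Ωp) (hΩn : 0 < Ωn)
    (hΩf : 0 < Ωf) {an Ppeak : ℝ} (han : 0 < an) (I : ℝ) (hPpeak : 0 < Ppeak)
    (lawg : HasLaw (fun ω => (‖hp ω‖ ^ 2, mrcGain fun i => hn i ω, mrcGain fun j => hf j ω))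
      ((expMeasure Ωp⁻¹).prod ((gammaMeasure Nn Ωn⁻¹).prod (gammaMeasure Nf Ωf⁻¹))) μ) :
    Integrable (fun ω => oneBitSumRateMin an I Ppeak
      (hp ω) (fun i => hn i ω) (fun j => hf j ω)) μ := by
  have := isProbabilityMeasure_expMeasure (inv_pos.mpr hΩp)
  have hrate : Integrable (fun p : ℝ × ℝ × ℝ =>
      (Iic (I / Ppeak)).indicator (fun _ => (Real.log 2)⁻¹) p.1 * natSumRate an Ppeak p.2)
      ((expMeasure Ωp⁻¹).prod ((gammaMeasure Nn Ωn⁻¹).prod (gammaMeasure Nf Ωf⁻¹))) :=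
    ((integrable_const _).indicator measurableSet_Iic).mul_prod
      (integrable_natSumRate (by positivity) (by positivity) (inv_pos.mpr hΩn) (inv_pos.mpr hΩf)
        han hPpeak)
  rw [← lawg.map_eq] at hrate
  simpa only [oneBitSumRateMin_eq_indicator_mul_natSumRate, Function.comp_def] using
    hrate.comp_aemeasurable lawg.aemeasurable

theorem integral_oneBitSumRateMin {γ : Measure (ℝ × ℝ)} [SFinite γ] (hΩp : 0 < Ωp)
    (an : ℝ) {I Ppeak : ℝ} (hτ : 0 ≤ I / Ppeak)
    (lawg : HasLaw (fun ω => (‖hp ω‖ ^ 2, mrcGain fun i => hn i ω, mrcGain fun j => hf j ω))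
      ((expMeasure Ωp⁻¹).prod γ) μ) :
    ∫ ω, oneBitSumRateMin an I Ppeak (hp ω) (fun i => hn i ω) (fun j => hf j ω) ∂μ =
      (1 - Real.exp (-(I / Ppeak) / Ωp)) / Real.log 2 * ∫ p, natSumRate an Ppeak p ∂γ := by
  have := isProbabilityMeasure_expMeasure (inv_pos.mpr hΩp)
  have hmeas : Measurable fun p : ℝ × ℝ × ℝ =>
      (Iic (I / Ppeak)).indicator (fun _ => (Real.log 2)⁻¹) p.1 * natSumRate an Ppeak p.2 :=
    ((measurable_const.indicator measurableSet_Iic).comp measurable_fst).mul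
      ((measurable_natSumRate an Ppeak).comp measurable_snd)
  have hsend : (1 - Real.exp (-(I / Ppeak) / Ωp)) / Real.log 2 =
      ∫ x, (Iic (I / Ppeak)).indicator (fun _ => (Real.log 2)⁻¹) x ∂expMeasure Ωp⁻¹ := by
    rw [integral_indicator_const _ measurableSet_Iic,
      measureReal_expMeasure_Iic (inv_pos.mpr hΩp) hτ, smul_eq_mul, neg_div,
      ← div_eq_inv_mul, ← div_eq_mul_inv]
  simp only [oneBitSumRateMin_eq_indicator_mul_natSumRate]
  rw [hsend, ← integral_prod_mul]
  exact lawg.integral_comp hmeas.aestronglyMeasurable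

end Channel

end NOMA

end

theorem mainTheorem10_general {S : Type*} [MeasurableSpace S] (μ : Measure S)
    (Nn Nf : ℕ) (hNn : 1 ≤ Nn) (hNf : 1 ≤ Nf)
    (Ωp Ωn Ωf : ℝ) (hΩp : 0 < Ωp) (hΩn : 0 < Ωn) (hΩf : 0 < Ωf)
    (an af : ℝ) (han : 0 < an) (haf : 0 ≤ af) (hsum : an + af = 1)
    (I Ppeak : ℝ) (hI : 0 ≤ I) (hPpeak : 0 < Ppeak)
    (hp : S → ℂ) (hn : Fin Nn → S → ℂ) (hf : Fin Nf → S → ℂ)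
    (lawp : HasLaw hp (NOMA.complexNormal Ωp) μ)
    (lawn : ∀ i, HasLaw (hn i) (NOMA.complexNormal Ωn) μ)
    (lawf : ∀ j, HasLaw (hf j) (NOMA.complexNormal Ωf) μ)
    (hindep : iIndepFun (Sum.elim (fun _ : Unit => hp) (Sum.elim hn hf)) μ)
    (τ Ω : ℝ) (hτ : τ = I / Ppeak) (hΩ : Ω = Ωn * Ωf / (Ωn + Ωf)) :
    Integrable (fun ω => NOMA.oneBitSumRate an af I Ppeak
      (hp ω) (fun i => hn i ω) (fun j => hf j ω)) μ ∧
    Integrable (fun ω => NOMA.oneBitSumRateMin an I Ppeak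
      (hp ω) (fun i => hn i ω) (fun j => hf j ω)) μ ∧
    ∫ ω, NOMA.oneBitSumRate an af I Ppeak (hp ω) (fun i => hn i ω) (fun j => hf j ω) ∂μ =
      ∫ ω, NOMA.oneBitSumRateMin an I Ppeak (hp ω) (fun i => hn i ω) (fun j => hf j ω) ∂μ ∧
    ((∫ ω, NOMA.oneBitSumRate an af I Ppeak (hp ω) (fun i => hn i ω) (fun j => hf j ω) ∂μ : ℝ) :
        ℂ) =
      (((1 - Real.exp (-τ / Ωp)) / Real.log 2 : ℝ) : ℂ) *
        ((1 / (Complex.Gamma Nn * (Ωn : ℂ) ^ Nn * ((an : ℂ) * Ppeak) ^ Nn)) *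
            NOMA.gTerm Nn (1 / (Ωn * an * Ppeak))
          + (1 / (Complex.Gamma Nn * (Ωn : ℂ) ^ Nn)) *
            ∑ k ∈ Finset.range Nf,
              (1 / ((k.factorial : ℂ) * (Ωf : ℂ) ^ k * (Ppeak : ℂ) ^ (Nn + k))) *
                (NOMA.gTerm (Nn + k) (1 / (Ω * Ppeak))
                  - (1 / (an : ℂ) ^ (Nn + k)) * NOMA.gTerm (Nn + k) (1 / (Ω * an * Ppeak)))
          + (1 / (Complex.Gamma Nf * (Ωf : ℂ) ^ Nf)) *
            ∑ l ∈ Finset.range Nn,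
              (1 / ((l.factorial : ℂ) * (Ωn : ℂ) ^ l * (Ppeak : ℂ) ^ (Nf + l))) *
                (NOMA.gTerm (Nf + l) (1 / (Ω * Ppeak))
                  - (1 / (an : ℂ) ^ (Nf + l)) * NOMA.gTerm (Nf + l) (1 / (Ω * an * Ppeak)))) := by
  have hΩinv : Ω⁻¹ = Ωn⁻¹ + Ωf⁻¹ := by rw [hΩ]; field_simp; ring
  have lawg := NOMA.hasLaw_gains hNn hNf hΩp hΩn hΩf lawp lawn lawf hindep
  have hprobn := isProbabilityMeasure_gammaMeasure (Nat.cast_pos.mpr hNn) (inv_pos.mpr hΩn)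
  have hprobf := isProbabilityMeasure_gammaMeasure (Nat.cast_pos.mpr hNf) (inv_pos.mpr hΩf)
  have hint := NOMA.integrable_oneBitSumRateMin hNn hNf hΩp hΩn hΩf han I hPpeak lawg
  simp only [NOMA.oneBitSumRate_eq_oneBitSumRateMin han.le haf hsum I hPpeak.le]
  refine ⟨hint, hint, trivial, ?_⟩
  rw [NOMA.integral_oneBitSumRateMin hΩp an (by positivity) lawg, Complex.ofReal_mul,
    NOMA.integral_natSumRate hNn hNf hΩn hΩf hΩinv han hPpeak, hτ]

theorem mainTheorem10 {S : Type*} [MeasurableSpace S] (μ : Measure S) [IsProbabilityMeasure μ]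
    (Nn Nf : ℕ) (hNn : 1 ≤ Nn) (hNf : 1 ≤ Nf)
    (Ωp Ωn Ωf : ℝ) (hΩp : 0 < Ωp) (hΩn : 0 < Ωn) (hΩf : 0 < Ωf)
    (an af : ℝ) (han : 0 < an) (hlt : an < af) (hsum : an + af = 1)
    (I Ppeak : ℝ) (hI : 0 < I) (hPpeak : 0 < Ppeak)
    (hp : S → ℂ) (hn : Fin Nn → S → ℂ) (hf : Fin Nf → S → ℂ)
    (lawp : HasLaw hp (NOMA.complexNormal Ωp) μ)
    (lawn : ∀ i, HasLaw (hn i) (NOMA.complexNormal Ωn) μ)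
    (lawf : ∀ j, HasLaw (hf j) (NOMA.complexNormal Ωf) μ)
    (hindep : iIndepFun (Sum.elim (fun _ : Unit => hp) (Sum.elim hn hf)) μ)
    (τ Ω : ℝ) (hτ : τ = I / Ppeak) (hΩ : Ω = Ωn * Ωf / (Ωn + Ωf)) :
    Integrable (fun ω => NOMA.oneBitSumRate an af I Ppeak
      (hp ω) (fun i => hn i ω) (fun j => hf j ω)) μ ∧
    Integrable (fun ω => NOMA.oneBitSumRateMin an I Ppeak
      (hp ω) (fun i => hn i ω) (fun j => hf j ω)) μ ∧
    ∫ ω, NOMA.oneBitSumRate an af I Ppeak (hp ω) (fun i => hn i ω) (fun j => hf j ω) ∂μ =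
      ∫ ω, NOMA.oneBitSumRateMin an I Ppeak (hp ω) (fun i => hn i ω) (fun j => hf j ω) ∂μ ∧
    ((∫ ω, NOMA.oneBitSumRate an af I Ppeak (hp ω) (fun i => hn i ω) (fun j => hf j ω) ∂μ : ℝ) :
        ℂ) =
      (((1 - Real.exp (-τ / Ωp)) / Real.log 2 : ℝ) : ℂ) *
        ((1 / (Complex.Gamma Nn * (Ωn : ℂ) ^ Nn * ((an : ℂ) * Ppeak) ^ Nn)) *
            NOMA.gTerm Nn (1 / (Ωn * an * Ppeak))
          + (1 / (Complex.Gamma Nn * (Ωn : ℂ) ^ Nn)) *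
            ∑ k ∈ Finset.range Nf,
              (1 / ((k.factorial : ℂ) * (Ωf : ℂ) ^ k * (Ppeak : ℂ) ^ (Nn + k))) *
                (NOMA.gTerm (Nn + k) (1 / (Ω * Ppeak))
                  - (1 / (an : ℂ) ^ (Nn + k)) * NOMA.gTerm (Nn + k) (1 / (Ω * an * Ppeak)))
          + (1 / (Complex.Gamma Nf * (Ωf : ℂ) ^ Nf)) *
            ∑ l ∈ Finset.range Nn,
              (1 / ((l.factorial : ℂ) * (Ωn : ℂ) ^ l * (Ppeak : ℂ) ^ (Nf + l))) *
                (NOMA.gTerm (Nf + l) (1 / (Ω * Ppeak))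
                  - (1 / (an : ℂ) ^ (Nf + l)) * NOMA.gTerm (Nf + l) (1 / (Ω * an * Ppeak)))) :=
  mainTheorem10_general μ Nn Nf hNn hNf Ωp Ωn Ωf hΩp hΩn hΩf an af han (by linarith) hsum I Ppeak
    hI.le hPpeak hp hn hf lawp lawn lawf hindep τ Ω hτ hΩ
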